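/- Let $M$ be a complete smooth Riemannian manifold (without boundary) of dimension $d$, with Riemannian distance $\mathrm{d}(\cdot,\cdot)$ and Levi-Civita connection $\nabla$. Let $U\subseteq M$ be open, let $V\subseteq M\times\mathbb{R}$ be open with $U\times[0,1]\subseteq V$, and let $f\in C^2(V,\mathbb{R})$. For $(x,\lambda)\in V$ let $\operatorname{grad} f(x,\lambda)\in T_xM$ be the Riemannian gradient of $f(\cdot,\lambda)$ at $x$, let $\operatorname{Hess} f(x,\lambda)\colon T_xM\to T_xM$, $\xi\mapsto\nabla_\xi \operatorname{grad} f(\cdot,\lambda)$, be the Riemannian Hessian of $f(\cdot,\lambda)$ at $x$, and let $\frac{\partial}{\partial\lambda}\operatorname{grad} f(x,\lambda)\in T_xM$ be the derivative of $\lambda\mapsto\operatorname{grad} f(x,\lambda)$ in the fixed vector space $T_xM$. Assume that there are $x_0\in U$ with $\operatorname{grad} f(x_0,0)=0$ and a constant $L>0$ such that $B(x_0,L)=\{x\in M : \mathrm{d}(x_0,x)<L\}\subseteq U$, and that for every $(z,\lambda)\in U\times[0,1]$ 1. $\operatorname{rank}\operatorname{Hess} f(z,\lambda)=d$, 2. $\bigl\|\operatorname{Hess}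 f(z,\lambda)^{-1}\bigl[\tfrac{\partial}{\partial\lambda}\operatorname{grad} f(z,\lambda)\bigr]\bigr\|_z<L$. Then there exist an open interval $J\supset[0,1]$ and a curve $x\in C^1(J,M)$ with $x(\lambda)\in U$ for all $\lambda\in[0,1]$ such that $$x(0)=x_0,\qquad \operatorname{grad} f(x(\lambda),\lambda)=0\quad\text{for all }\lambda\in[0,1],$$ and this curve satisfies the Riemannian Davidenko equation $$\operatorname{Hess} f(x(\lambda),\lambda)[\dot x(\lambda)]+\frac{\partial}{\partial\lambda}\operatorname{grad} f(x(\lambda),\lambda)=0\quad\text{for all }\lambda\in[0,1].$$ -/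

import Mathlib

open Bundle Set NormedSpace
open scoped Manifold ContDiff Topology

noncomputable section

set_option linter.unusedSectionVars false

namespace RiemannianContinuation

section Gradient

variable {E : Type*} [NormedAddCommGroup E] [NormedSpace ℝ E] [FiniteDimensional ℝ E]
  {H : Type*} [TopologicalSpace H] (I : ModelWithCorners ℝ E H)
  {M : Type*} [TopologicalSpace M] [ChartedSpace H M] [IsManifold I 1 M]
  [RiemannianBundle (fun (x : M) ↦ TangentSpace I x)]

theorem completeSpace_tangentSpace (x : M) : CompleteSpace (TangentSpace I x) :=
  haveI : FiniteDimensional ℝ (TangentSpace I x) := inferInstanceAs (FiniteDimensional ℝ E)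
  FiniteDimensional.complete ℝ (TangentSpace I x)

/-- The vector of `T_x M` that represents a linear form on `T_x M` for the Riemannian metric. -/
def sharp (x : M) (φ : TangentSpace I x →L[ℝ] ℝ) : TangentSpace I x :=
  haveI := completeSpace_tangentSpace I x
  (InnerProductSpace.toDual ℝ (TangentSpace I x)).symm φ

variable {I} in
theorem inner_sharp (x : M) (φ : TangentSpace I x →L[ℝ] ℝ) (v : TangentSpace I x) :
    inner ℝ (sharp I x φ) v = φ v :=
  haveI := completeSpace_tangentSpace I x
  InnerProductSpace.toDual_symm_apply

/-- The Riemannian gradient of `f(·, lam)` at `x`: the vector representing the differential. -/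
def grad (f : M × ℝ → ℝ) (x : M) (lam : ℝ) : TangentSpace I x :=
  sharp I x (mvfderiv I (fun y ↦ f (y, lam)) x)

/-- The partial derivative in the parameter of `lam ↦ grad f(x, lam)`, a curve in the fixed vector
space `T_x M`. -/
def partialGrad (f : M × ℝ → ℝ) (x : M) (lam : ℝ) : TangentSpace I x :=
  deriv (fun t ↦ grad I f x t) lam

end Gradient

section Connection

variable {E : Type*} [NormedAddCommGroup E] [NormedSpace ℝ E] [FiniteDimensional ℝ E]
  {H : Type*} [TopologicalSpace H] (I : ModelWithCorners ℝ E H)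
  {M : Type*} [TopologicalSpace M] [ChartedSpace H M] [IsManifold I 2 M]
  [RiemannianBundle (fun (x : M) ↦ TangentSpace I x)]
  [IsContMDiffRiemannianBundle I 1 E (fun (x : M) ↦ TangentSpace I x)]

/-- Half of the right-hand side of the Koszul formula: the number that `⟨∇_X Y, Z⟩` has to be
at `x`. -/
def koszul (X Y Z : Π x : M, TangentSpace I x) (x : M) : ℝ :=
  2⁻¹ * (mvfderiv I (fun y ↦ inner ℝ (Y y) (Z y)) x (X x)
    + mvfderiv I (fun y ↦ inner ℝ (X y) (Z y)) x (Y x)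
    - mvfderiv I (fun y ↦ inner ℝ (X y) (Y y)) x (Z x)
    + inner ℝ (VectorField.mlieBracket I X Y x) (Z x)
    - inner ℝ (VectorField.mlieBracket I X Z x) (Y x)
    - inner ℝ (VectorField.mlieBracket I Y Z x) (X x))

variable {I}

theorem mdifferentiableAt_inner {x : M} {X Y : Π x : M, TangentSpace I x}
    (hX : MDiffAt (T% X) x) (hY : MDiffAt (T% Y) x) :
    MDiffAt (fun y ↦ inner ℝ (X y) (Y y)) x :=
  MDifferentiableAt.inner_bundle (E := fun x : M ↦ TangentSpace I x) hX hY

theorem mvfderiv_inner_add_left {x : M} {X X' Y : Π x : M, TangentSpace I x}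
    (hX : MDiffAt (T% X) x) (hX' : MDiffAt (T% X') x) (hY : MDiffAt (T% Y) x) :
    mvfderiv I (fun y ↦ inner ℝ ((X + X') y) (Y y)) x
      = mvfderiv I (fun y ↦ inner ℝ (X y) (Y y)) x
        + mvfderiv I (fun y ↦ inner ℝ (X' y) (Y y)) x := by
  rw [← mvfderiv_fun_add (mdifferentiableAt_inner hX hY) (mdifferentiableAt_inner hX' hY)]
  simp only [Pi.add_apply, inner_add_left]

theorem mvfderiv_inner_smul_left {x : M} {f : M → ℝ} {X Y : Π x : M, TangentSpace I x}
    (hf : MDiffAt f x) (hX : MDiffAt (T% X) x) (hY : MDiffAt (T% Y) x) :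
    mvfderiv I (fun y ↦ inner ℝ ((f • X) y) (Y y)) x
      = f x • mvfderiv I (fun y ↦ inner ℝ (X y) (Y y)) x
        + inner ℝ (X x) (Y x) • mvfderiv I f x := by
  rw [← mvfderiv_fun_mul hf (mdifferentiableAt_inner hX hY)]
  simp only [Pi.smul_apply', real_inner_smul_left]

theorem mvfderiv_inner_add_right {x : M} {X X' Y : Π x : M, TangentSpace I x}
    (hX : MDiffAt (T% X) x) (hX' : MDiffAt (T% X') x) (hY : MDiffAt (T% Y) x) :
    mvfderiv I (fun y ↦ inner ℝ (Y y) ((X + X') y)) x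
      = mvfderiv I (fun y ↦ inner ℝ (Y y) (X y)) x
        + mvfderiv I (fun y ↦ inner ℝ (Y y) (X' y)) x := by
  simpa only [real_inner_comm] using mvfderiv_inner_add_left hX hX' hY

theorem mvfderiv_inner_smul_right {x : M} {f : M → ℝ} {X Y : Π x : M, TangentSpace I x}
    (hf : MDiffAt f x) (hX : MDiffAt (T% X) x) (hY : MDiffAt (T% Y) x) :
    mvfderiv I (fun y ↦ inner ℝ (Y y) ((f • X) y)) x
      = f x • mvfderiv I (fun y ↦ inner ℝ (Y y) (X y)) x
        + inner ℝ (Y x) (X x) • mvfderiv I f x := by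
  simpa only [real_inner_comm] using mvfderiv_inner_smul_left hf hX hY

theorem koszul_tensorial_left {x : M} {Y Z : Π x : M, TangentSpace I x}
    (hY : MDiffAt (T% Y) x) (hZ : MDiffAt (T% Z) x) :
    TensorialAt I E (fun X ↦ koszul I X Y Z x) x where
  smul {f X} hf hX := by
    simp only [koszul, mvfderiv_inner_smul_left hf hX hY, mvfderiv_inner_smul_left hf hX hZ,
      VectorField.mlieBracket_smul_left hf hX]
    simp [inner_add_left, real_inner_smul_left, real_inner_smul_right]
    ring
  add {X X'} hX hX' := by
    simp only [koszul, mvfderiv_inner_add_left hX hX' hY, mvfderiv_inner_add_left hX hX' hZ,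
      VectorField.mlieBracket_add_left hX hX']
    simp [inner_add_left, inner_add_right]
    ring

theorem koszul_tensorial_right {x : M} {X Y : Π x : M, TangentSpace I x}
    (hX : MDiffAt (T% X) x) (hY : MDiffAt (T% Y) x) :
    TensorialAt I E (fun Z ↦ koszul I X Y Z x) x where
  smul {f Z} hf hZ := by
    simp only [koszul, mvfderiv_inner_smul_right hf hZ hY, mvfderiv_inner_smul_right hf hZ hX,
      VectorField.mlieBracket_smul_right hf hZ]
    simp [inner_add_left, real_inner_smul_left, real_inner_smul_right]
    rw [real_inner_comm (X x) (Z x), real_inner_comm (Y x) (Z x)]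
    ring
  add {Z Z'} hZ hZ' := by
    simp only [koszul, mvfderiv_inner_add_right hZ hZ' hY, mvfderiv_inner_add_right hZ hZ' hX,
      VectorField.mlieBracket_add_right hZ hZ']
    simp [inner_add_left, inner_add_right]
    ring

theorem koszul_add_middle {x : M} {X Y Y' Z : Π x : M, TangentSpace I x}
    (hX : MDiffAt (T% X) x) (hY : MDiffAt (T% Y) x) (hY' : MDiffAt (T% Y') x)
    (hZ : MDiffAt (T% Z) x) :
    koszul I X (Y + Y') Z x = koszul I X Y Z x + koszul I X Y' Z x := by
  simp only [koszul, mvfderiv_inner_add_right hY hY' hX, mvfderiv_inner_add_left hY hY' hZ,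
    VectorField.mlieBracket_add_right hY hY', VectorField.mlieBracket_add_left hY hY']
  simp [inner_add_left, inner_add_right]
  ring

theorem koszul_smul_middle {x : M} {f : M → ℝ} {X Y Z : Π x : M, TangentSpace I x}
    (hf : MDiffAt f x) (hX : MDiffAt (T% X) x) (hY : MDiffAt (T% Y) x)
    (hZ : MDiffAt (T% Z) x) :
    koszul I X (f • Y) Z x
      = f x * koszul I X Y Z x + mvfderiv I f x (X x) * inner ℝ (Y x) (Z x) := by
  simp only [koszul, mvfderiv_inner_smul_right hf hY hX, mvfderiv_inner_smul_left hf hY hZ,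
    VectorField.mlieBracket_smul_right hf hY, VectorField.mlieBracket_smul_left hf hY]
  simp [inner_add_left, real_inner_smul_left, real_inner_smul_right]
  rw [real_inner_comm (X x) (Y x)]
  ring

/-- The Koszul form at `x` as a bilinear form in the direction `X` and the test vector `Z`. -/
def koszulHom (Y : Π x : M, TangentSpace I x) (x : M) (hY : MDiffAt (T% Y) x) :
    TangentSpace I x →L[ℝ] TangentSpace I x →L[ℝ] ℝ :=
  TensorialAt.mkHom₂ (fun X Z ↦ koszul I X Y Z x) x
    (fun _ hZ ↦ koszul_tensorial_left hY hZ) (fun _ hX ↦ koszul_tensorial_right hX hY)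

theorem koszulHom_apply {X Y Z : Π x : M, TangentSpace I x} {x : M} (hX : MDiffAt (T% X) x)
    (hY : MDiffAt (T% Y) x) (hZ : MDiffAt (T% Z) x) :
    koszulHom Y x hY (X x) (Z x) = koszul I X Y Z x :=
  TensorialAt.mkHom₂_apply _ _ hX hZ

open scoped Classical in
/-- `v ↦ ∇_v Y` at `x`: the vector whose inner products are given by the Koszul formula. -/
def leviCivitaFun (Y : Π x : M, TangentSpace I x) (x : M) :
    TangentSpace I x →L[ℝ] TangentSpace I x :=
  haveI : FiniteDimensional ℝ (TangentSpace I x) := inferInstanceAs (FiniteDimensional ℝ E)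
  if hY : MDiffAt (T% Y) x then
    LinearMap.toContinuousLinearMap
      { toFun := fun v ↦ sharp I x (koszulHom Y x hY v)
        map_add' := fun v w ↦ ext_inner_right ℝ fun z ↦ by
          simp [inner_sharp, inner_add_left]
        map_smul' := fun c v ↦ ext_inner_right ℝ fun z ↦ by
          simp [inner_sharp, real_inner_smul_left] }
  else 0

theorem inner_leviCivitaFun {X Y Z : Π x : M, TangentSpace I x} {x : M}
    (hX : MDiffAt (T% X) x) (hY : MDiffAt (T% Y) x) (hZ : MDiffAt (T% Z) x) :
    inner ℝ (leviCivitaFun Y x (X x)) (Z x) = koszul I X Y Z x := by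
  rw [leviCivitaFun, dif_pos hY, ← koszulHom_apply hX hY hZ]
  exact inner_sharp x _ _

theorem mdifferentiableAt_extend_tangent {x : M} (v : TangentSpace I x) :
    MDiffAt (T% (FiberBundle.extend E v)) x :=
  FiberBundle.mdifferentiableAt_extend I E v

theorem inner_leviCivitaFun_extend {Y : Π x : M, TangentSpace I x} {x : M}
    (hY : MDiffAt (T% Y) x) (v w : TangentSpace I x) :
    inner ℝ (leviCivitaFun Y x v) w
      = koszul I (FiberBundle.extend E v) Y (FiberBundle.extend E w) x := by
  rw [← inner_leviCivitaFun (mdifferentiableAt_extend_tangent v) hY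
    (mdifferentiableAt_extend_tangent w), FiberBundle.extend_apply_self,
    FiberBundle.extend_apply_self]

variable (I M) in
/-- The Riemannian (Levi-Civita) connection of `M`; `leviCivita I M Y x v` is `∇_v Y` at `x`. -/
def leviCivita : CovariantDerivative I E (fun x : M ↦ TangentSpace I x) where
  toFun := leviCivitaFun
  isCovariantDerivativeOnUniv :=
    { add := fun {Y Y' x} hY hY' _ ↦ by
        ext v
        refine ext_inner_right ℝ fun w ↦ ?_
        have hadd : MDiffAt (T% (Y + Y')) x := mdifferentiableAt_add_section hY hY'
        rw [add_apply, inner_add_left, inner_leviCivitaFun_extend hadd,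
          inner_leviCivitaFun_extend hY, inner_leviCivitaFun_extend hY']
        exact koszul_add_middle (mdifferentiableAt_extend_tangent v) hY hY'
          (mdifferentiableAt_extend_tangent w)
      leibniz := fun {Y f x} hY hf _ ↦ by
        ext v
        refine ext_inner_right ℝ fun w ↦ ?_
        have hsmul : MDiffAt (T% (f • Y)) x := hf.smul_section hY
        rw [inner_leviCivitaFun_extend hsmul, koszul_smul_middle hf
          (mdifferentiableAt_extend_tangent v) hY (mdifferentiableAt_extend_tangent w),
          ← inner_leviCivitaFun_extend hY]
        simp [inner_add_left, real_inner_smul_left] }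

/-- The Levi-Civita connection is torsion-free. -/
theorem leviCivita_torsion : (leviCivita I M).torsion = 0 := by
  rw [CovariantDerivative.torsion_eq_zero_iff]
  intro X Y x hX hY
  refine ext_inner_right ℝ fun w ↦ ?_
  have hw := mdifferentiableAt_extend_tangent w
  have h1 := inner_leviCivitaFun hX hY hw
  have h2 := inner_leviCivitaFun hY hX hw
  rw [FiberBundle.extend_apply_self] at h1 h2
  rw [inner_sub_left]
  refine (congrArg₂ (· - ·) h1 h2).trans ?_
  have hs : VectorField.mlieBracket I Y X x = - VectorField.mlieBracket I X Y x :=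
    VectorField.mlieBracket_swap_apply
  have hc : (fun y ↦ inner ℝ (Y y) (X y)) = fun y : M ↦ inner ℝ (X y) (Y y) :=
    funext fun y ↦ real_inner_comm _ _
  simp only [koszul, FiberBundle.extend_apply_self, hs, hc, inner_neg_left]
  ring

/-- The Levi-Civita connection is compatible with the metric:
`X⟨Y, Z⟩ = ⟨∇_X Y, Z⟩ + ⟨Y, ∇_X Z⟩`. -/
theorem leviCivita_metric {X Y Z : Π x : M, TangentSpace I x} {x : M}
    (hX : MDiffAt (T% X) x) (hY : MDiffAt (T% Y) x) (hZ : MDiffAt (T% Z) x) :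
    mvfderiv I (fun y ↦ inner ℝ (Y y) (Z y)) x (X x)
      = inner ℝ (leviCivita I M Y x (X x)) (Z x) + inner ℝ (Y x) (leviCivita I M Z x (X x)) := by
  have h1 : inner ℝ (leviCivita I M Y x (X x)) (Z x) = koszul I X Y Z x :=
    inner_leviCivitaFun hX hY hZ
  have h2 : inner ℝ (leviCivita I M Z x (X x)) (Y x) = koszul I X Z Y x :=
    inner_leviCivitaFun hX hZ hY
  have hs : VectorField.mlieBracket I Z Y x = - VectorField.mlieBracket I Y Z x :=
    VectorField.mlieBracket_swap_apply
  have hc : (fun y ↦ inner ℝ (Z y) (Y y)) = fun y : M ↦ inner ℝ (Y y) (Z y) :=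
    funext fun y ↦ real_inner_comm _ _
  rw [real_inner_comm (leviCivita I M Z x (X x)) (Y x), h1, h2]
  simp only [koszul, hs, hc, inner_neg_left]
  ring

variable (I)

/-- The Riemannian Hessian of `f(·, lam)` at `x`: `ξ ↦ ∇_ξ grad f(·, lam)`. -/
def hess (f : M × ℝ → ℝ) (x : M) (lam : ℝ) : TangentSpace I x →L[ℝ] TangentSpace I x :=
  leviCivita I M (fun y ↦ grad I f y lam) x

end Connection

end RiemannianContinuation

end

noncomputable section

set_option linter.unusedSectionVars false

namespace RiemannianContinuation

section ChartRepresentation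

variable {E : Type*} [NormedAddCommGroup E] [NormedSpace ℝ E]
  {M : Type*} [TopologicalSpace M] [ChartedSpace E M]

/-- The parametrized function `f` read in the chart at `z`. -/
def chartRep (f : M × ℝ → ℝ) (z : M) (s : ℝ) (u : E) : ℝ :=
  f ((extChartAt 𝓘(ℝ, E) z).symm u, s)

/-- The derivative in the space variable of `f` read in the chart at `z`. -/
def chartGrad (f : M × ℝ → ℝ) (z : M) (p : ℝ × E) : E →L[ℝ] ℝ :=
  fderiv ℝ (chartRep f z p.1) p.2

variable [IsManifold 𝓘(ℝ, E) 2 M] {f : M × ℝ → ℝ} {z y : M} {s : ℝ}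

theorem contDiffAt_chartRep (hy : y ∈ (extChartAt 𝓘(ℝ, E) z).source)
    (hf : ContMDiffAt (𝓘(ℝ, E).prod 𝓘(ℝ, ℝ)) 𝓘(ℝ, ℝ) 2 f (y, s)) :
    ContDiffAt ℝ 2 (fun p : ℝ × E ↦ chartRep f z p.1 p.2) (s, extChartAt 𝓘(ℝ, E) z y) := by
  rw [← contMDiffAt_iff_contDiffAt]
  have hsymm : ContMDiffAt 𝓘(ℝ, E) 𝓘(ℝ, E) 2 (extChartAt 𝓘(ℝ, E) z).symm
      (extChartAt 𝓘(ℝ, E) z y) :=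
    (contMDiffOn_extChartAt_symm z).contMDiffAt
      (extChartAt_target_mem_nhds' ((extChartAt 𝓘(ℝ, E) z).map_source hy))
  have hsnd : ContMDiffAt 𝓘(ℝ, ℝ × E) 𝓘(ℝ, E) 2 (Prod.snd : ℝ × E → E)
      (s, extChartAt 𝓘(ℝ, E) z y) := contMDiffAt_iff_contDiffAt.2 contDiffAt_snd
  have hfst : ContMDiffAt 𝓘(ℝ, ℝ × E) 𝓘(ℝ, ℝ) 2 (Prod.fst : ℝ × E → ℝ)
      (s, extChartAt 𝓘(ℝ, E) z y) := contMDiffAt_iff_contDiffAt.2 contDiffAt_fst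
  exact ContMDiffAt.comp_of_eq hf ((hsymm.comp_of_eq hsnd rfl).prodMk hfst)
    (congrArg (·, s) ((extChartAt 𝓘(ℝ, E) z).left_inv hy))

theorem contDiffAt_chartGrad (hy : y ∈ (extChartAt 𝓘(ℝ, E) z).source)
    (hf : ContMDiffAt (𝓘(ℝ, E).prod 𝓘(ℝ, ℝ)) 𝓘(ℝ, ℝ) 2 f (y, s)) :
    ContDiffAt ℝ 1 (chartGrad f z) (s, extChartAt 𝓘(ℝ, E) z y) := by
  refine ContDiffAt.fderiv (n := 2) (f := fun (p : ℝ × E) (u : E) ↦ chartRep f z p.1 u)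
    (g := Prod.snd) ?_ contDiffAt_snd (by norm_num)
  have h : ContDiffAt ℝ 2 (fun q : (ℝ × E) × E ↦ ((q.1.1, q.2) : ℝ × E))
      ((s, extChartAt 𝓘(ℝ, E) z y), extChartAt 𝓘(ℝ, E) z y) := by fun_prop
  exact ContDiffAt.comp (g := fun p : ℝ × E ↦ chartRep f z p.1 p.2)
    ((s, extChartAt 𝓘(ℝ, E) z y), extChartAt 𝓘(ℝ, E) z y)
    (contDiffAt_chartRep hy hf) h

theorem contMDiffAt_slice
    (hf : ContMDiffAt (𝓘(ℝ, E).prod 𝓘(ℝ, ℝ)) 𝓘(ℝ, ℝ) 2 f (y, s)) :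
    ContMDiffAt 𝓘(ℝ, E) 𝓘(ℝ, ℝ) 2 (fun x ↦ f (x, s)) y :=
  ContMDiffAt.comp (f := fun x : M ↦ (x, s)) y hf (contMDiffAt_id.prodMk contMDiffAt_const)

theorem mvfderiv_self_eq_chartGrad
    (hf : ContMDiffAt (𝓘(ℝ, E).prod 𝓘(ℝ, ℝ)) 𝓘(ℝ, ℝ) 2 f (z, s)) :
    mvfderiv 𝓘(ℝ, E) (fun x ↦ f (x, s)) z = chartGrad f z (s, extChartAt 𝓘(ℝ, E) z z) := by
  rw [((contMDiffAt_slice hf).mdifferentiableAt two_ne_zero).mvfderiv]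
  simp only [modelWithCornersSelf_coe, range_id, fderivWithin_univ]
  rfl

theorem mvfderiv_eq_chartGrad_comp (hy : y ∈ (extChartAt 𝓘(ℝ, E) z).source)
    (hf : ContMDiffAt (𝓘(ℝ, E).prod 𝓘(ℝ, ℝ)) 𝓘(ℝ, ℝ) 2 f (y, s)) :
    mvfderiv 𝓘(ℝ, E) (fun x ↦ f (x, s)) y
      = chartGrad f z (s, extChartAt 𝓘(ℝ, E) z y) ∘L
        (trivializationAt E (TangentSpace 𝓘(ℝ, E)) z).continuousLinearMapAt ℝ y := by
  have hy' : y ∈ (chartAt E z).source := by simpa using hy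
  have heq : (fun x ↦ f (x, s)) =ᶠ[𝓝 y] chartRep f z s ∘ extChartAt 𝓘(ℝ, E) z := by
    filter_upwards [(isOpen_extChartAt_source z).mem_nhds hy] with x hx
    exact congrArg (fun x ↦ f (x, s)) ((extChartAt 𝓘(ℝ, E) z).left_inv hx).symm
  have hd : DifferentiableAt ℝ (chartRep f z s) (extChartAt 𝓘(ℝ, E) z y) :=
    ((contDiffAt_chartRep hy hf).comp (extChartAt 𝓘(ℝ, E) z y)
      (f := fun u : E ↦ (s, u)) (by fun_prop)).differentiableAt two_ne_zero
  have hm := (hd.hasFDerivAt.hasMFDerivAt.comp y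
    (mdifferentiableAt_extChartAt (I := 𝓘(ℝ, E)) hy').hasMFDerivAt).congr_of_eventuallyEq heq
  rw [TangentBundle.continuousLinearMapAt_trivializationAt hy']
  have := hm.mfderiv
  ext v
  exact congrArg (fun A ↦ A v) this

end ChartRepresentation

section Gradient

variable {E : Type*} [NormedAddCommGroup E] [NormedSpace ℝ E] [FiniteDimensional ℝ E]
  {M : Type*} [TopologicalSpace M] [ChartedSpace E M] [IsManifold 𝓘(ℝ, E) 2 M]
  [RiemannianBundle (fun x : M ↦ TangentSpace 𝓘(ℝ, E) x)]
  {f : M × ℝ → ℝ} {z y : M} {s : ℝ}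

theorem sharp_eq_zero_iff {x : M} {φ : TangentSpace 𝓘(ℝ, E) x →L[ℝ] ℝ} :
    sharp 𝓘(ℝ, E) x φ = 0 ↔ φ = 0 := by
  have := completeSpace_tangentSpace 𝓘(ℝ, E) x
  exact LinearIsometryEquiv.map_eq_zero_iff _

theorem grad_eq_zero_iff (hy : y ∈ (extChartAt 𝓘(ℝ, E) z).source)
    (hf : ContMDiffAt (𝓘(ℝ, E).prod 𝓘(ℝ, ℝ)) 𝓘(ℝ, ℝ) 2 f (y, s)) :
    grad 𝓘(ℝ, E) f y s = 0 ↔ chartGrad f z (s, extChartAt 𝓘(ℝ, E) z y) = 0 := by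
  have hy' : y ∈ (trivializationAt E (TangentSpace 𝓘(ℝ, E)) z).baseSet := by simpa using hy
  rw [grad, sharp_eq_zero_iff, mvfderiv_eq_chartGrad_comp hy hf]
  constructor
  · intro h
    ext v
    have := congrArg (fun A ↦ A ((trivializationAt E (TangentSpace 𝓘(ℝ, E)) z).symmL ℝ y v)) h
    rwa [ContinuousLinearMap.comp_apply, Trivialization.continuousLinearMapAt_symmL _ hy'] at this
  · intro h
    rw [h, ContinuousLinearMap.zero_comp]

end Gradient

section LinearAlgebra

theorem isInvertible_of_injective_dual {E : Type*} [NormedAddCommGroup E] [NormedSpace ℝ E]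
    [FiniteDimensional ℝ E] {A : E →L[ℝ] E →L[ℝ] ℝ} (hA : Function.Injective A) :
    A.IsInvertible := by
  have hdim : Module.finrank ℝ E = Module.finrank ℝ (E →L[ℝ] ℝ) := by
    rw [← (LinearMap.toContinuousLinearMap (𝕜 := ℝ) (E := E) (F' := ℝ)).finrank_eq]
    exact (Subspace.dual_finrank_eq (K := ℝ) (V := E)).symm
  exact ⟨(LinearMap.linearEquivOfInjective (A : E →ₗ[ℝ] E →L[ℝ] ℝ) hA hdim).toContinuousLinearEquiv,
    by ext; rfl⟩

theorem mdifferentiableAt_of_clm_apply {E F G : Type*} [NormedAddCommGroup E] [NormedSpace ℝ E]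
    [FiniteDimensional ℝ E] [NormedAddCommGroup F] [NormedSpace ℝ F] [NormedAddCommGroup G]
    [NormedSpace ℝ G] {M : Type*} [TopologicalSpace M] [ChartedSpace G M]
    {g : M → E →L[ℝ] F} {z : M} (hg : ∀ v, MDiffAt (fun y ↦ g y v) z) : MDiffAt g z := by
  let b := Module.finBasis ℝ E
  have h : g = fun y ↦ ∑ i, ContinuousLinearMap.smulRightL ℝ E F
      (LinearMap.toContinuousLinearMap (b.coord i)) (g y (b i)) := by
    funext y
    ext v
    conv_lhs => rw [← b.sum_repr v]
    simp [-Module.Basis.sum_repr]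
  rw [h, ← Finset.sum_fn]
  exact MDifferentiableAt.sum fun i _ ↦
    (ContinuousLinearMap.smulRightL ℝ E F (LinearMap.toContinuousLinearMap
      (b.coord i))).differentiableAt.mdifferentiableAt.comp z (hg (b i))

end LinearAlgebra

section Hessian

variable {E : Type*} [NormedAddCommGroup E] [NormedSpace ℝ E] [FiniteDimensional ℝ E]
  {M : Type*} [TopologicalSpace M] [ChartedSpace E M] [IsManifold 𝓘(ℝ, E) 2 M]
  [RiemannianBundle (fun x : M ↦ TangentSpace 𝓘(ℝ, E) x)]
  {f : M × ℝ → ℝ} {z y : M} {s : ℝ}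

variable (E) in
/-- The metric at `y` in the trivialization of the tangent bundle at `z`. -/
def metricRep (z y : M) : E →L[ℝ] E →L[ℝ] ℝ :=
  (innerSL ℝ (E := TangentSpace 𝓘(ℝ, E) y)).bilinearComp
    ((trivializationAt E (TangentSpace 𝓘(ℝ, E)) z).symmL ℝ y)
    ((trivializationAt E (TangentSpace 𝓘(ℝ, E)) z).symmL ℝ y)

theorem metricRep_apply (z y : M) (a b : E) :
    metricRep E z y a b = inner ℝ ((trivializationAt E (TangentSpace 𝓘(ℝ, E)) z).symmL ℝ y a)
      ((trivializationAt E (TangentSpace 𝓘(ℝ, E)) z).symmL ℝ y b) := rfl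

theorem isInvertible_metricRep
    (hy : y ∈ (trivializationAt E (TangentSpace 𝓘(ℝ, E)) z).baseSet) :
    (metricRep E z y).IsInvertible := by
  refine isInvertible_of_injective_dual ((injective_iff_map_eq_zero _).2 fun a ha ↦ ?_)
  have h : metricRep E z y a a = 0 := by rw [ha]; rfl
  rw [metricRep_apply, inner_self_eq_zero] at h
  rw [← Trivialization.continuousLinearMapAt_symmL (R := ℝ) _ hy a, h, map_zero]

theorem mdifferentiableAt_metricRep
    [IsContMDiffRiemannianBundle 𝓘(ℝ, E) 1 E (fun x : M ↦ TangentSpace 𝓘(ℝ, E) x)] :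
    MDiffAt (fun y : M ↦ metricRep E z y) z := by
  refine mdifferentiableAt_of_clm_apply fun a ↦ mdifferentiableAt_of_clm_apply fun b ↦ ?_
  set e := trivializationAt E (TangentSpace 𝓘(ℝ, E)) z with he
  have hz : z ∈ e.baseSet := FiberBundle.mem_baseSet_trivializationAt' z
  have key := mdifferentiableAt_inner (mdifferentiableAt_extend_tangent (e.symmL ℝ z a))
    (mdifferentiableAt_extend_tangent (e.symmL ℝ z b))
  refine key.congr_of_eventuallyEq ?_
  have hext : ∀ c : E, ∀ y ∈ e.baseSet, FiberBundle.extend E (e.symmL ℝ z c) y = e.symmL ℝ y c := by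
    intro c y hy
    rw [FiberBundle.extend, ← he, ← e.continuousLinearMapAt_apply_of_mem (R := ℝ) hz,
      e.continuousLinearMapAt_symmL hz, e.symmL_apply hy]
  filter_upwards [e.open_baseSet.mem_nhds hz] with y hy
  rw [metricRep_apply, hext a y hy, hext b y hy]

theorem mdifferentiableAt_chartGrad
    (hf : ContMDiffAt (𝓘(ℝ, E).prod 𝓘(ℝ, ℝ)) 𝓘(ℝ, ℝ) 2 f (z, s)) :
    MDiffAt (fun y : M ↦ chartGrad f z (s, extChartAt 𝓘(ℝ, E) z y)) z := by
  have h1 : DifferentiableAt ℝ (fun u : E ↦ chartGrad f z (s, u)) (extChartAt 𝓘(ℝ, E) z z) :=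
    (((contDiffAt_chartGrad (mem_extChartAt_source z) hf).differentiableAt one_ne_zero).comp _
      (by fun_prop : DifferentiableAt ℝ (fun u : E ↦ (s, u)) (extChartAt 𝓘(ℝ, E) z z)) :)
  exact h1.mdifferentiableAt.comp z (mdifferentiableAt_extChartAt (mem_chart_source E z))

theorem eventually_contMDiffAt_slice
    (hf : ContMDiffAt (𝓘(ℝ, E).prod 𝓘(ℝ, ℝ)) 𝓘(ℝ, ℝ) 2 f (z, s)) :
    ∀ᶠ y in 𝓝 z, ContMDiffAt (𝓘(ℝ, E).prod 𝓘(ℝ, ℝ)) 𝓘(ℝ, ℝ) 2 f (y, s) :=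
  (by fun_prop : ContinuousAt (fun y : M ↦ (y, s)) z).eventually
    ((contMDiffAt_iff_contMDiffAt_nhds (by decide)).1 hf)

/-- The gradient of a `C^2` function is a differentiable vector field. -/
theorem mdifferentiableAt_grad
    [IsContMDiffRiemannianBundle 𝓘(ℝ, E) 1 E (fun x : M ↦ TangentSpace 𝓘(ℝ, E) x)]
    (hf : ContMDiffAt (𝓘(ℝ, E).prod 𝓘(ℝ, ℝ)) 𝓘(ℝ, ℝ) 2 f (z, s)) :
    MDiffAt (T% (fun y ↦ grad 𝓘(ℝ, E) f y s)) z := by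
  rw [mdifferentiableAt_section]
  set e := trivializationAt E (TangentSpace 𝓘(ℝ, E)) z with he
  have hz : z ∈ e.baseSet := FiberBundle.mem_baseSet_trivializationAt' z
  have hinv : MDiffAt (fun y : M ↦ (metricRep E z y).inverse) z :=
    ((isInvertible_metricRep hz).contDiffAt_map_inverse (n := 1)
      |>.differentiableAt one_ne_zero).mdifferentiableAt.comp z mdifferentiableAt_metricRep
  refine (hinv.clm_apply (mdifferentiableAt_chartGrad hf)).congr_of_eventuallyEq ?_
  filter_upwards [e.open_baseSet.mem_nhds hz, eventually_contMDiffAt_slice hf] with y hy hfy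
  have hy' : y ∈ (extChartAt 𝓘(ℝ, E) z).source := by simpa [he] using hy
  symm
  rw [(isInvertible_metricRep hy).inverse_apply_eq,
    ← e.continuousLinearMapAt_apply_of_mem (R := ℝ) hy]
  ext w
  rw [metricRep_apply, e.symmL_continuousLinearMapAt hy, grad, inner_sharp,
    mvfderiv_eq_chartGrad_comp hy' hfy, ContinuousLinearMap.comp_apply,
    e.continuousLinearMapAt_symmL hy]

theorem trivializationAt_tangent_self (w : TangentSpace 𝓘(ℝ, E) z) :
    (trivializationAt E (TangentSpace 𝓘(ℝ, E)) z ⟨z, w⟩).2 = w := by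
  rw [TangentBundle.trivializationAt_apply]
  exact congrArg (fun A : E →L[ℝ] E ↦ A w)
    (fderivWithin_extChartAt_comp_extChartAt_symm_range (𝕜 := ℝ) (I := 𝓘(ℝ, E)) (x := z))

theorem continuousLinearMapAt_extend
    (hy : y ∈ (trivializationAt E (TangentSpace 𝓘(ℝ, E)) z).baseSet)
    (w : TangentSpace 𝓘(ℝ, E) z) :
    (trivializationAt E (TangentSpace 𝓘(ℝ, E)) z).continuousLinearMapAt ℝ y
      (FiberBundle.extend E w y) = w := by
  rw [FiberBundle.extend, ← Trivialization.symmL_apply (R := ℝ) _ hy,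
    Trivialization.continuousLinearMapAt_symmL _ hy, trivializationAt_tangent_self]

theorem mvfderiv_chartGrad_apply
    (hf : ContMDiffAt (𝓘(ℝ, E).prod 𝓘(ℝ, ℝ)) 𝓘(ℝ, ℝ) 2 f (z, s)) (v w : E) :
    mvfderiv 𝓘(ℝ, E) (fun y : M ↦ chartGrad f z (s, extChartAt 𝓘(ℝ, E) z y) w) z v
      = fderiv ℝ (chartGrad f z) (s, extChartAt 𝓘(ℝ, E) z z) (0, v) w := by
  have hdiff : MDiffAt (fun y : M ↦ chartGrad f z (s, extChartAt 𝓘(ℝ, E) z y) w) z :=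
    (mdifferentiableAt_chartGrad hf).clm_apply mdifferentiableAt_const
  have hd := (contDiffAt_chartGrad (mem_extChartAt_source z) hf).differentiableAt one_ne_zero
  have h1 : HasFDerivAt (fun u : E ↦ chartGrad f z (s, u))
      (fderiv ℝ (chartGrad f z) (s, extChartAt 𝓘(ℝ, E) z z) ∘L ContinuousLinearMap.inr ℝ ℝ E)
      (extChartAt 𝓘(ℝ, E) z z) :=
    hd.hasFDerivAt.comp (extChartAt 𝓘(ℝ, E) z z) (hasFDerivAt_prodMk_right s _)
  have h2 := h1.clm_apply (hasFDerivAt_const w (extChartAt 𝓘(ℝ, E) z z))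
  have h3 : writtenInExtChartAt 𝓘(ℝ, E) 𝓘(ℝ, ℝ) z
      (fun y : M ↦ chartGrad f z (s, extChartAt 𝓘(ℝ, E) z y) w)
      =ᶠ[𝓝 (extChartAt 𝓘(ℝ, E) z z)] fun u ↦ chartGrad f z (s, u) w := by
    filter_upwards [extChartAt_target_mem_nhds (I := 𝓘(ℝ, E)) z] with u hu
    exact congrArg (fun u ↦ chartGrad f z (s, u) w) ((extChartAt 𝓘(ℝ, E) z).right_inv hu)
  rw [hdiff.mvfderiv]
  simp only [modelWithCornersSelf_coe, range_id, fderivWithin_univ]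
  rw [(h2.congr_of_eventuallyEq h3).fderiv, ContinuousLinearMap.comp_zero, zero_add]
  rfl

/-- At a critical point the Riemannian Hessian is represented by the second derivative in a
chart. -/
theorem inner_hess_of_grad_eq_zero
    [IsContMDiffRiemannianBundle 𝓘(ℝ, E) 1 E (fun x : M ↦ TangentSpace 𝓘(ℝ, E) x)]
    (hf : ContMDiffAt (𝓘(ℝ, E).prod 𝓘(ℝ, ℝ)) 𝓘(ℝ, ℝ) 2 f (z, s))
    (hz : grad 𝓘(ℝ, E) f z s = 0) (v w : TangentSpace 𝓘(ℝ, E) z) :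
    inner ℝ (hess 𝓘(ℝ, E) f z s v) w
      = fderiv ℝ (chartGrad f z) (s, extChartAt 𝓘(ℝ, E) z z) ((0, v) : ℝ × E) w := by
  have hmetric := leviCivita_metric (mdifferentiableAt_extend_tangent v)
    (mdifferentiableAt_grad hf) (mdifferentiableAt_extend_tangent w)
  rw [hz, inner_zero_left, add_zero, FiberBundle.extend_apply_self,
    FiberBundle.extend_apply_self] at hmetric
  rw [hess, ← hmetric]
  have hze : z ∈ (trivializationAt E (TangentSpace 𝓘(ℝ, E)) z).baseSet :=
    FiberBundle.mem_baseSet_trivializationAt' z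
  have heq : (fun y ↦ inner ℝ (grad 𝓘(ℝ, E) f y s) (FiberBundle.extend E w y))
      =ᶠ[𝓝 z] fun y ↦ chartGrad f z (s, extChartAt 𝓘(ℝ, E) z y) w := by
    filter_upwards [(Trivialization.open_baseSet _).mem_nhds hze,
      eventually_contMDiffAt_slice hf] with y hy hfy
    have hy' : y ∈ (extChartAt 𝓘(ℝ, E) z).source := by simpa using hy
    rw [grad, inner_sharp, mvfderiv_eq_chartGrad_comp hy' hfy, ContinuousLinearMap.comp_apply,
      continuousLinearMapAt_extend hy]
  refine Eq.trans ?_ (mvfderiv_chartGrad_apply hf v w)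
  rw [mvfderiv, mvfderiv, heq.mfderiv_eq]
  rfl

theorem sharp_add (x : M) (φ ψ : TangentSpace 𝓘(ℝ, E) x →L[ℝ] ℝ) :
    sharp 𝓘(ℝ, E) x (φ + ψ) = sharp 𝓘(ℝ, E) x φ + sharp 𝓘(ℝ, E) x ψ :=
  ext_inner_right ℝ fun v ↦ by simp [inner_add_left, inner_sharp]

theorem sharp_smul (x : M) (c : ℝ) (φ : TangentSpace 𝓘(ℝ, E) x →L[ℝ] ℝ) :
    sharp 𝓘(ℝ, E) x (c • φ) = c • sharp 𝓘(ℝ, E) x φ :=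
  ext_inner_right ℝ fun v ↦ by simp [real_inner_smul_left, inner_sharp]

theorem inner_partialGrad
    (hf : ContMDiffAt (𝓘(ℝ, E).prod 𝓘(ℝ, ℝ)) 𝓘(ℝ, ℝ) 2 f (z, s))
    (w : TangentSpace 𝓘(ℝ, E) z) :
    inner ℝ (partialGrad 𝓘(ℝ, E) f z s) w
      = fderiv ℝ (chartGrad f z) (s, extChartAt 𝓘(ℝ, E) z z) ((1, 0) : ℝ × E) w := by
  have hd := (contDiffAt_chartGrad (mem_extChartAt_source z) hf).differentiableAt one_ne_zero
  have h1 : HasDerivAt (fun t : ℝ ↦ chartGrad f z (t, extChartAt 𝓘(ℝ, E) z z))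
      (fderiv ℝ (chartGrad f z) (s, extChartAt 𝓘(ℝ, E) z z) ((1, 0) : ℝ × E)) s :=
    HasFDerivAt.comp_hasDerivAt (f := fun t : ℝ ↦ (t, extChartAt 𝓘(ℝ, E) z z)) s hd.hasFDerivAt
      ((hasDerivAt_id s).prodMk (hasDerivAt_const s _))
  let T : (E →L[ℝ] ℝ) →ₗ[ℝ] TangentSpace 𝓘(ℝ, E) z :=
    { toFun := fun φ ↦ sharp 𝓘(ℝ, E) z φ
      map_add' := sharp_add z
      map_smul' := sharp_smul z }
  have h2 := (LinearMap.toContinuousLinearMap T).hasFDerivAt.comp_hasDerivAt s h1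
  have h3 : (fun t ↦ grad 𝓘(ℝ, E) f z t) =ᶠ[𝓝 s]
      (LinearMap.toContinuousLinearMap T) ∘
        fun t : ℝ ↦ chartGrad f z (t, extChartAt 𝓘(ℝ, E) z z) := by
    filter_upwards [(by fun_prop : ContinuousAt (fun t : ℝ ↦ (z, t)) s).eventually
      ((contMDiffAt_iff_contMDiffAt_nhds (by decide)).1 hf)] with t ht
    rw [grad, mvfderiv_self_eq_chartGrad ht]
    rfl
  rw [partialGrad, (h2.congr_of_eventuallyEq h3).deriv]
  exact inner_sharp z _ w

end Hessian

section CriticalCurves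

variable {E : Type*} [NormedAddCommGroup E] [NormedSpace ℝ E] [FiniteDimensional ℝ E]
  {M : Type*} [TopologicalSpace M] [ChartedSpace E M] [IsManifold 𝓘(ℝ, E) 2 M]
  [RiemannianBundle (fun x : M ↦ TangentSpace 𝓘(ℝ, E) x)]
  [IsContMDiffRiemannianBundle 𝓘(ℝ, E) 1 E (fun x : M ↦ TangentSpace 𝓘(ℝ, E) x)]
  {f : M × ℝ → ℝ} {z : M} {s : ℝ}

theorem eventually_grad_eq_zero_iff
    (hf : ContMDiffAt (𝓘(ℝ, E).prod 𝓘(ℝ, ℝ)) 𝓘(ℝ, ℝ) 2 f (z, s)) :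
    ∀ᶠ p : M × ℝ in 𝓝 (z, s), grad 𝓘(ℝ, E) f p.1 p.2 = 0 ↔
      chartGrad f z (p.2, extChartAt 𝓘(ℝ, E) z p.1) = 0 := by
  filter_upwards [continuousAt_fst.eventually (extChartAt_source_mem_nhds (I := 𝓘(ℝ, E)) z),
    (contMDiffAt_iff_contMDiffAt_nhds (by decide)).1 hf] with p hp hfp
  exact grad_eq_zero_iff hp hfp

theorem hasDerivAt_extChartAt_comp {x : ℝ → M} (hx : MDiffAt x s) :
    HasDerivAt (fun t ↦ extChartAt 𝓘(ℝ, E) (x s) (x t))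
      (mfderiv 𝓘(ℝ, ℝ) 𝓘(ℝ, E) x s (1 : ℝ) : E) s := by
  obtain ⟨A, hA⟩ : ∃ A : ℝ →L[ℝ] E, A = mfderiv 𝓘(ℝ, ℝ) 𝓘(ℝ, E) x s := ⟨_, rfl⟩
  have h : HasFDerivWithinAt (fun t ↦ extChartAt 𝓘(ℝ, E) (x s) (x t)) A (range 𝓘(ℝ, ℝ)) s := by
    rw [hA]
    exact hx.hasMFDerivAt.2
  rw [modelWithCornersSelf_coe, range_id, hasFDerivWithinAt_univ] at h
  rw [← hA]
  exact h.hasDerivAt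

/-- The Riemannian Davidenko equation along a differentiable curve of critical points. -/
theorem davidenko {x : ℝ → M} (hx : MDiffAt x s)
    (hf : ContMDiffAt (𝓘(ℝ, E).prod 𝓘(ℝ, ℝ)) 𝓘(ℝ, ℝ) 2 f (x s, s))
    (hcrit : ∀ᶠ t in 𝓝 s, grad 𝓘(ℝ, E) f (x t) t = 0) :
    hess 𝓘(ℝ, E) f (x s) s (mfderiv 𝓘(ℝ, ℝ) 𝓘(ℝ, E) x s (1 : ℝ))
      + partialGrad 𝓘(ℝ, E) f (x s) s = 0 := by
  have hd := (contDiffAt_chartGrad (mem_extChartAt_source (x s)) hf).differentiableAt one_ne_zero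
  have hcurve : HasDerivAt (fun t ↦ chartGrad f (x s) (t, extChartAt 𝓘(ℝ, E) (x s) (x t)))
      (fderiv ℝ (chartGrad f (x s)) (s, extChartAt 𝓘(ℝ, E) (x s) (x s))
        ((1, mfderiv 𝓘(ℝ, ℝ) 𝓘(ℝ, E) x s (1 : ℝ)) : ℝ × E)) s :=
    HasFDerivAt.comp_hasDerivAt (f := fun t : ℝ ↦ (t, extChartAt 𝓘(ℝ, E) (x s) (x t))) s
      hd.hasFDerivAt ((hasDerivAt_id s).prodMk (hasDerivAt_extChartAt_comp hx))
  have hzero : (fun t ↦ chartGrad f (x s) (t, extChartAt 𝓘(ℝ, E) (x s) (x t)))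
      =ᶠ[𝓝 s] fun _ ↦ 0 := by
    have hc : ContinuousAt (fun t ↦ (x t, t)) s := hx.continuousAt.prodMk continuousAt_id
    filter_upwards [hcrit, hc.eventually (eventually_grad_eq_zero_iff hf)] with t ht hiff
    exact hiff.1 ht
  have h0 := hcurve.unique ((hasDerivAt_const s (0 : E →L[ℝ] ℝ)).congr_of_eventuallyEq hzero)
  refine ext_inner_right ℝ fun w ↦ ?_
  rw [inner_add_left, inner_hess_of_grad_eq_zero hf hcrit.self_of_nhds, inner_partialGrad hf,
    inner_zero_left]
  have hsplit : ((1, mfderiv 𝓘(ℝ, ℝ) 𝓘(ℝ, E) x s (1 : ℝ)) : ℝ × E)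
      = ((0, mfderiv 𝓘(ℝ, ℝ) 𝓘(ℝ, E) x s (1 : ℝ)) : ℝ × E) + ((1, 0) : ℝ × E) :=
    Prod.ext (zero_add (1 : ℝ)).symm (add_zero (_ : E)).symm
  rw [hsplit, map_add] at h0
  exact congrArg (fun A : E →L[ℝ] ℝ ↦ A w) h0

/-- Near a nondegenerate critical point the critical points form a `C^1` curve. -/
theorem exists_critical_curve
    (hf : ContMDiffAt (𝓘(ℝ, E).prod 𝓘(ℝ, ℝ)) 𝓘(ℝ, ℝ) 2 f (z, s))
    (hz : grad 𝓘(ℝ, E) f z s = 0) (hinj : Function.Injective (hess 𝓘(ℝ, E) f z s)) :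
    ∃ γ : ℝ → M, γ s = z ∧ ContMDiffAt 𝓘(ℝ, ℝ) 𝓘(ℝ, E) 1 γ s ∧
      (∀ᶠ t in 𝓝 s, grad 𝓘(ℝ, E) f (γ t) t = 0) ∧
      ∀ᶠ p : M × ℝ in 𝓝 (z, s), grad 𝓘(ℝ, E) f p.1 p.2 = 0 → p.1 = γ p.2 := by
  have hG := contDiffAt_chartGrad (mem_extChartAt_source z) hf
  have hG0 : chartGrad f z (s, extChartAt 𝓘(ℝ, E) z z) = 0 :=
    (grad_eq_zero_iff (mem_extChartAt_source z) hf).1 hz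
  have hinv : (fderiv ℝ (chartGrad f z) (s, extChartAt 𝓘(ℝ, E) z z) ∘L
      ContinuousLinearMap.inr ℝ ℝ E).IsInvertible := by
    refine isInvertible_of_injective_dual ((injective_iff_map_eq_zero _).2 fun v hv ↦ ?_)
    refine (injective_iff_map_eq_zero (hess 𝓘(ℝ, E) f z s)).1 hinj v ?_
    refine ext_inner_right ℝ fun w ↦ ?_
    exact (inner_hess_of_grad_eq_zero hf hz v w).trans
      ((congrArg (fun A : E →L[ℝ] ℝ ↦ A w) hv).trans (inner_zero_left w).symm)
  set ψ := hG.implicitFunction one_ne_zero hinv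
  have hψs : ψ s = extChartAt 𝓘(ℝ, E) z z := hG.implicitFunction_apply_self one_ne_zero hinv
  have hψd : ContDiffAt ℝ 1 ψ s := hG.contDiffAt_implicitFunction one_ne_zero hinv
  have hψz : ∀ᶠ t in 𝓝 s, chartGrad f z (t, ψ t) = 0 := by
    simpa only [hG0] using hG.eventually_apply_implicitFunction one_ne_zero hinv
  have hψu : ∀ᶠ q : ℝ × E in 𝓝 (s, extChartAt 𝓘(ℝ, E) z z),
      chartGrad f z q = 0 ↔ ψ q.1 = q.2 := by
    simpa only [hG0] using hG.eventually_apply_eq_iff_implicitFunction one_ne_zero hinv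
  have hγs : (extChartAt 𝓘(ℝ, E) z).symm (ψ s) = z := by rw [hψs, extChartAt_to_inv]
  have hsymm : ContMDiffAt 𝓘(ℝ, E) 𝓘(ℝ, E) 1 (extChartAt 𝓘(ℝ, E) z).symm (ψ s) := by
    rw [hψs]
    exact (contMDiffOn_extChartAt_symm z).contMDiffAt (extChartAt_target_mem_nhds z)
  have hγ : ContMDiffAt 𝓘(ℝ, ℝ) 𝓘(ℝ, E) 1 (fun t ↦ (extChartAt 𝓘(ℝ, E) z).symm (ψ t)) s :=
    hsymm.comp s hψd.contMDiffAt
  refine ⟨fun t ↦ (extChartAt 𝓘(ℝ, E) z).symm (ψ t), hγs, hγ, ?_, ?_⟩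
  · have hc : Filter.Tendsto (fun t ↦ ((extChartAt 𝓘(ℝ, E) z).symm (ψ t), t)) (𝓝 s)
        (𝓝 (z, s)) := by
      have := hγ.continuousAt.prodMk continuousAt_id
      rwa [ContinuousAt, hγs] at this
    have hmem : ∀ᶠ t in 𝓝 s, ψ t ∈ (extChartAt 𝓘(ℝ, E) z).target := by
      refine hψd.continuousAt.eventually ?_
      rw [hψs]
      exact extChartAt_target_mem_nhds z
    filter_upwards [hc.eventually (eventually_grad_eq_zero_iff hf), hψz, hmem] with t h1 h2 h3
    refine h1.2 ?_
    rw [(extChartAt 𝓘(ℝ, E) z).right_inv h3]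
    exact h2
  · have hc : ContinuousAt (fun p : M × ℝ ↦ (p.2, extChartAt 𝓘(ℝ, E) z p.1)) (z, s) :=
      continuousAt_snd.prodMk
        (ContinuousAt.comp (f := Prod.fst) (x := (z, s)) (continuousAt_extChartAt z)
          continuousAt_fst)
    filter_upwards [eventually_grad_eq_zero_iff hf, hc.eventually hψu,
      continuousAt_fst.eventually (extChartAt_source_mem_nhds (I := 𝓘(ℝ, E)) z)]
      with p h1 h2 h3 h4
    simp only [h2.1 (h1.1 h4), (extChartAt 𝓘(ℝ, E) z).left_inv h3]

theorem hess_injective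
    (hrank : Module.finrank ℝ (hess 𝓘(ℝ, E) f z s).range = Module.finrank ℝ E) :
    Function.Injective (hess 𝓘(ℝ, E) f z s) := by
  have : FiniteDimensional ℝ (TangentSpace 𝓘(ℝ, E) z) := inferInstanceAs (FiniteDimensional ℝ E)
  have h := LinearMap.finrank_range_add_finrank_ker
    (hess 𝓘(ℝ, E) f z s : TangentSpace 𝓘(ℝ, E) z →ₗ[ℝ] TangentSpace 𝓘(ℝ, E) z)
  have hE : Module.finrank ℝ (TangentSpace 𝓘(ℝ, E) z) = Module.finrank ℝ E := rfl
  have hk : Module.finrank ℝ (LinearMap.ker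
    (hess 𝓘(ℝ, E) f z s : TangentSpace 𝓘(ℝ, E) z →ₗ[ℝ] TangentSpace 𝓘(ℝ, E) z)) = 0 := by
    rw [hE, ← hrank] at h
    exact Nat.add_eq_left.1 h
  exact LinearMap.ker_eq_bot.1 (Submodule.finrank_eq_zero.1 hk)

theorem hess_isInvertible (hinj : Function.Injective (hess 𝓘(ℝ, E) f z s)) :
    (hess 𝓘(ℝ, E) f z s).IsInvertible := by
  have : FiniteDimensional ℝ (TangentSpace 𝓘(ℝ, E) z) := inferInstanceAs (FiniteDimensional ℝ E)
  exact ⟨(LinearEquiv.ofInjectiveEndo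
    (hess 𝓘(ℝ, E) f z s : TangentSpace 𝓘(ℝ, E) z →ₗ[ℝ] TangentSpace 𝓘(ℝ, E) z)
    hinj).toContinuousLinearEquiv, by ext; rfl⟩

theorem norm_velocity_eq {x : ℝ → M} (hx : MDiffAt x s)
    (hf : ContMDiffAt (𝓘(ℝ, E).prod 𝓘(ℝ, ℝ)) 𝓘(ℝ, ℝ) 2 f (x s, s))
    (hcrit : ∀ᶠ t in 𝓝 s, grad 𝓘(ℝ, E) f (x t) t = 0)
    (hinj : Function.Injective (hess 𝓘(ℝ, E) f (x s) s)) :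
    ‖mfderiv 𝓘(ℝ, ℝ) 𝓘(ℝ, E) x s (1 : ℝ)‖
      = ‖(hess 𝓘(ℝ, E) f (x s) s).inverse (partialGrad 𝓘(ℝ, E) f (x s) s)‖ := by
  rw [eq_neg_of_add_eq_zero_right (davidenko hx hf hcrit), map_neg,
    (hess_isInvertible hinj).inverse_apply_self, norm_neg]

end CriticalCurves

section Continuation

variable {E : Type*} [NormedAddCommGroup E] [NormedSpace ℝ E] [FiniteDimensional ℝ E]
  {M : Type*} [EMetricSpace M] [ChartedSpace E M] [IsManifold 𝓘(ℝ, E) 2 M]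
  [RiemannianBundle (fun x : M ↦ TangentSpace 𝓘(ℝ, E) x)]
  [IsContMDiffRiemannianBundle 𝓘(ℝ, E) 1 E (fun x : M ↦ TangentSpace 𝓘(ℝ, E) x)]
  {f : M × ℝ → ℝ} {U : Set M} {x y : ℝ → M} {x₀ : M} {s T L : ℝ}

variable (E) in
/-- The curve `x` is `C^1` near `s`, consists of critical points near `s`, and `x s ∈ U`. -/
structure IsCriticalCurveAt (f : M × ℝ → ℝ) (U : Set M) (x : ℝ → M) (s : ℝ) : Prop where
  contMDiffAt : ContMDiffAt 𝓘(ℝ, ℝ) 𝓘(ℝ, E) 1 x s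
  grad_eq_zero : ∀ᶠ t in 𝓝 s, grad 𝓘(ℝ, E) f (x t) t = 0
  mem : x s ∈ U

variable (E) in
/-- On `U × [0, 1]` the function `f` is `C^2` with injective Hessian and the velocity field of the
Davidenko equation has norm less than `L`. -/
structure IsNondegenerate (f : M × ℝ → ℝ) (U : Set M) (L : ℝ) : Prop where
  isOpen : IsOpen U
  contMDiffAt : ∀ z ∈ U, ∀ s ∈ Icc (0 : ℝ) 1,
    ContMDiffAt (𝓘(ℝ, E).prod 𝓘(ℝ, ℝ)) 𝓘(ℝ, ℝ) 2 f (z, s)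
  injective : ∀ z ∈ U, ∀ s ∈ Icc (0 : ℝ) 1, Function.Injective (hess 𝓘(ℝ, E) f z s)
  norm_lt : ∀ z ∈ U, ∀ s ∈ Icc (0 : ℝ) 1,
    ‖(hess 𝓘(ℝ, E) f z s).inverse (partialGrad 𝓘(ℝ, E) f z s)‖ < L

theorem IsCriticalCurveAt.eventually (hU : IsOpen U) (hx : IsCriticalCurveAt E f U x s) :
    ∀ᶠ t in 𝓝 s, IsCriticalCurveAt E f U x t := by
  filter_upwards [(contMDiffAt_iff_contMDiffAt_nhds (by decide)).1 hx.contMDiffAt,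
    hx.grad_eq_zero.eventually_nhds,
    hx.contMDiffAt.continuousAt.eventually (hU.mem_nhds hx.mem)] with t h1 h2 h3
  exact ⟨h1, h2, h3⟩

theorem IsCriticalCurveAt.congr (hx : IsCriticalCurveAt E f U x s) (h : y =ᶠ[𝓝 s] x) :
    IsCriticalCurveAt E f U y s where
  contMDiffAt := hx.contMDiffAt.congr_of_eventuallyEq h
  grad_eq_zero := by
    filter_upwards [hx.grad_eq_zero, h] with t h1 h2
    rwa [h2]
  mem := by rw [h.self_of_nhds]; exact hx.mem

theorem IsCriticalCurveAt.eventuallyEq (hN : IsNondegenerate E f U L) (hs : s ∈ Icc (0 : ℝ) 1)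
    (hx : IsCriticalCurveAt E f U x s) (hy : IsCriticalCurveAt E f U y s) (h : x s = y s) :
    x =ᶠ[𝓝 s] y := by
  obtain ⟨γ, -, -, -, huniq⟩ := exists_critical_curve (hN.contMDiffAt _ hx.mem s hs)
    hx.grad_eq_zero.self_of_nhds (hN.injective _ hx.mem s hs)
  have hcx : ContinuousAt (fun t ↦ (x t, t)) s :=
    hx.contMDiffAt.continuousAt.prodMk continuousAt_id
  have hcy : Filter.Tendsto (fun t ↦ (y t, t)) (𝓝 s) (𝓝 (x s, s)) := by
    rw [h]
    exact hy.contMDiffAt.continuousAt.prodMk continuousAt_id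
  filter_upwards [hcx.eventually huniq, hcy.eventually huniq, hx.grad_eq_zero, hy.grad_eq_zero]
    with t h1 h2 h3 h4
  exact (h1 h3).trans (h2 h4).symm

theorem eqOn_of_isCriticalCurveAt (hN : IsNondegenerate E f U L) (hT : T ≤ 1)
    (hx : ∀ s ∈ Icc 0 T, IsCriticalCurveAt E f U x s)
    (hy : ∀ s ∈ Icc 0 T, IsCriticalCurveAt E f U y s) (h : x 0 = y 0) : EqOn x y (Icc 0 T) := by
  have hclosed : IsClosed ({s | x s = y s} ∩ Icc 0 T) := by
    rw [inter_comm]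
    exact ContinuousOn.preimage_isClosed_of_isClosed (f := fun t ↦ (x t, y t))
      (fun t ht ↦ ((hx t ht).contMDiffAt.continuousAt.prodMk
        (hy t ht).contMDiffAt.continuousAt).continuousWithinAt) isClosed_Icc isClosed_diagonal
  refine hclosed.Icc_subset_of_forall_mem_nhdsWithin h fun t ht ↦ mem_nhdsWithin_of_mem_nhds ?_
  have htI := Ico_subset_Icc_self ht.2
  exact (hx t htI).eventuallyEq hN ⟨htI.1, htI.2.trans hT⟩ (hy t htI) ht.1

theorem edist_lt_of_isCriticalCurveAt [IsRiemannianManifold 𝓘(ℝ, E) M]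
    (hN : IsNondegenerate E f U L) {a b : ℝ} (ha : 0 ≤ a) (hab : a < b) (hb : b ≤ 1)
    (hx : ∀ s ∈ Icc a b, IsCriticalCurveAt E f U x s) :
    edist (x a) (x b) < ENNReal.ofReal (L * (b - a)) := by
  have hlt : ∀ t ∈ Icc a b,
      ‖mfderiv 𝓘(ℝ, ℝ) 𝓘(ℝ, E) x t (1 : ℝ)‖ₑ < ENNReal.ofReal L := by
    intro t ht
    have ht' : t ∈ Icc (0 : ℝ) 1 := ⟨ha.trans ht.1, ht.2.trans hb⟩
    have hm := (hx t ht).mem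
    have hnorm := hN.norm_lt _ hm t ht'
    rw [← norm_velocity_eq ((hx t ht).contMDiffAt.mdifferentiableAt one_ne_zero)
      (hN.contMDiffAt _ hm t ht') (hx t ht).grad_eq_zero (hN.injective _ hm t ht')] at hnorm
    rw [← ofReal_norm]
    exact (ENNReal.ofReal_lt_ofReal_iff_of_nonneg (norm_nonneg _)).2 hnorm
  have hconst : ∫⁻ _ in Icc a b, ENNReal.ofReal L = ENNReal.ofReal (L * (b - a)) := by
    rw [MeasureTheory.setLIntegral_const, Real.volume_Icc, ENNReal.ofReal_mul' (by linarith)]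
  rw [IsRiemannianManifold.out (I := 𝓘(ℝ, E)) (x a) (x b), ← hconst]
  refine (Manifold.riemannianEDist_le_pathELength
    (fun t ht ↦ (hx t ht).contMDiffAt.contMDiffWithinAt) rfl rfl hab.le).trans_lt ?_
  rw [Manifold.pathELength_eq_lintegral_mfderiv_Icc]
  refine MeasureTheory.setLIntegral_strict_mono measurableSet_Icc ?_ measurable_const ?_
    (Filter.Eventually.of_forall hlt)
  · simp [hab]
  · refine ((MeasureTheory.setLIntegral_mono measurable_const fun t ht ↦ (hlt t ht).le).trans_lt
      ?_).ne
    rw [hconst]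
    exact ENNReal.ofReal_lt_top

/-- A curve of critical points on `[0, T)` that starts at the centre of a ball of radius `L`
contained in `U` has a limit in `U`, and it extends to `[0, T]`. -/
theorem exists_extension_Icc [IsRiemannianManifold 𝓘(ℝ, E) M] [CompleteSpace M]
    (hN : IsNondegenerate E f U L) (hL : 0 < L)
    (hball : {z : M | edist x₀ z < ENNReal.ofReal L} ⊆ U) (hT0 : 0 < T) (hT : T ≤ 1)
    (h0 : x 0 = x₀) (hx : ∀ s ∈ Ico 0 T, IsCriticalCurveAt E f U x s) :
    ∃ y : ℝ → M, y 0 = x₀ ∧ ∀ s ∈ Icc 0 T, IsCriticalCurveAt E f U y s := by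
  have hdist : ∀ a ∈ Ico 0 T, ∀ b ∈ Ico 0 T, a < b →
      edist (x a) (x b) < ENNReal.ofReal (L * (b - a)) := fun a ha b hb hab ↦
    edist_lt_of_isCriticalCurveAt hN ha.1 hab (hb.2.le.trans hT)
      fun s hs ↦ hx s ⟨ha.1.trans hs.1, hs.2.trans_lt hb.2⟩
  have hlip : LipschitzOnWith L.toNNReal x (Ico 0 T) := by
    have key : ∀ a ∈ Ico 0 T, ∀ b ∈ Ico 0 T, a < b →
        edist (x a) (x b) ≤ L.toNNReal * edist a b := by
      intro a ha b hb hab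
      refine (hdist a ha b hb hab).le.trans ?_
      rw [edist_comm a b, edist_dist, Real.dist_eq, abs_of_pos (sub_pos.2 hab),
        ENNReal.ofReal_mul hL.le]
      rfl
    intro a ha b hb
    rcases lt_trichotomy a b with hab | rfl | hab
    · exact key a ha b hb hab
    · simp
    · rw [edist_comm (x a), edist_comm a]
      exact key b hb a ha hab
  have hIco : Ico 0 T ∈ 𝓝[<] T := Ico_mem_nhdsLT hT0
  obtain ⟨z, hz⟩ : ∃ z, Filter.Tendsto x (𝓝[<] T) (𝓝 z) := by
    have hc : Cauchy (𝓝[<] T) := (cauchy_nhds (a := T)).mono nhdsWithin_le_nhds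
    exact cauchy_map_iff_exists_tendsto.1
      (hc.map_of_le hlip.uniformContinuousOn (Filter.le_principal_iff.2 hIco))
  have hzU : z ∈ U := by
    refine hball ?_
    have hm : T / 2 ∈ Ico 0 T := ⟨by linarith, by linarith⟩
    have h1 := hdist 0 ⟨le_rfl, hT0⟩ (T / 2) hm (by linarith)
    rw [h0] at h1
    have h2 : edist (x (T / 2)) z ≤ ENNReal.ofReal (L * (T - T / 2)) := by
      refine le_of_tendsto (tendsto_const_nhds.edist hz) ?_
      filter_upwards [Ioo_mem_nhdsLT hm.2] with t ht
      refine (hdist _ hm t ⟨hm.1.trans ht.1.le, ht.2⟩ ht.1).le.trans ?_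
      exact ENNReal.ofReal_le_ofReal (by have := ht.2; gcongr)
    calc edist x₀ z ≤ edist x₀ (x (T / 2)) + edist (x (T / 2)) z := edist_triangle _ _ _
      _ < ENNReal.ofReal (L * (T / 2 - 0)) + ENNReal.ofReal (L * (T - T / 2)) :=
        ENNReal.add_lt_add_of_lt_of_le (h2.trans_lt ENNReal.ofReal_lt_top).ne h1 h2
      _ = ENNReal.ofReal (L * T) := by
        rw [← ENNReal.ofReal_add (by nlinarith) (by nlinarith)]
        congr 1
        ring
      _ ≤ ENNReal.ofReal L := ENNReal.ofReal_le_ofReal (by nlinarith)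
  have hTI : T ∈ Icc (0 : ℝ) 1 := ⟨hT0.le, hT⟩
  have hfz := hN.contMDiffAt z hzU T hTI
  have hpair : Filter.Tendsto (fun t ↦ (x t, t)) (𝓝[<] T) (𝓝 (z, T)) :=
    hz.prodMk_nhds (Filter.tendsto_id.mono_right nhdsWithin_le_nhds)
  have hzero : ∀ᶠ t in 𝓝[<] T, grad 𝓘(ℝ, E) f (x t) t = 0 := by
    filter_upwards [hIco] with t ht
    exact (hx t ht).grad_eq_zero.self_of_nhds
  have hgz : grad 𝓘(ℝ, E) f z T = 0 := by
    rw [grad_eq_zero_iff (mem_extChartAt_source z) hfz]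
    have hc : Filter.Tendsto (fun t ↦ (t, extChartAt 𝓘(ℝ, E) z (x t))) (𝓝[<] T)
        (𝓝 (T, extChartAt 𝓘(ℝ, E) z z)) :=
      (Filter.tendsto_id.mono_right nhdsWithin_le_nhds).prodMk_nhds
        ((continuousAt_extChartAt z).tendsto.comp hz)
    have hlim := (contDiffAt_chartGrad (mem_extChartAt_source z) hfz).continuousAt.tendsto.comp hc
    refine tendsto_nhds_unique hlim (tendsto_const_nhds.congr' ?_)
    filter_upwards [hzero, hpair.eventually (eventually_grad_eq_zero_iff hfz)] with t h1 h2
    exact (h2.1 h1).symm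
  obtain ⟨γ, hγz, hγd, hγ0, huniq⟩ := exists_critical_curve hfz hgz (hN.injective z hzU T hTI)
  have hγ : IsCriticalCurveAt E f U γ T := ⟨hγd, hγ0, by rwa [hγz]⟩
  have hxγ : ∀ᶠ t in 𝓝[<] T, x t = γ t := by
    filter_upwards [hzero, hpair.eventually huniq] with t h1 h2
    exact h2 h1
  refine ⟨fun t ↦ if t < T then x t else γ t, by simp [hT0, h0], fun s hs ↦ ?_⟩
  rcases hs.2.lt_or_eq with hsT | rfl
  · refine (hx s ⟨hs.1, hsT⟩).congr ?_
    filter_upwards [Iio_mem_nhds hsT] with t ht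
    exact if_pos ht
  · refine hγ.congr ?_
    filter_upwards [eventually_nhdsWithin_iff.1 hxγ] with t ht
    split_ifs with h
    · exact ht h
    · rfl

/-- Curves of critical points on all compact subintervals of `[0, T)` glue to one on `[0, T)`. -/
theorem exists_glue_Ico (hN : IsNondegenerate E f U L) (hT0 : 0 < T) (hT : T ≤ 1)
    (h : ∀ T' ∈ Ico 0 T, ∃ x : ℝ → M, x 0 = x₀ ∧ ∀ s ∈ Icc 0 T', IsCriticalCurveAt E f U x s) :
    ∃ x : ℝ → M, x 0 = x₀ ∧ ∀ s ∈ Ico 0 T, IsCriticalCurveAt E f U x s := by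
  have : Nonempty M := ⟨x₀⟩
  choose! c hc0 hc using h
  have hτ : ∀ t, t < T → (max t 0 + T) / 2 ∈ Ico 0 T := fun t ht ↦
    ⟨by have := le_max_right t 0; linarith, by have := max_lt ht hT0; linarith⟩
  refine ⟨fun t ↦ c ((max t 0 + T) / 2) t, hc0 _ (hτ 0 hT0), fun s hs ↦ ?_⟩
  have hsτ : s < (max s 0 + T) / 2 := by
    rw [max_eq_left hs.1]; linarith [hs.2]
  refine (hc _ (hτ s hs.2) s ⟨hs.1, hsτ.le⟩).congr ?_
  have hright : ∀ t, 0 ≤ t → t < (max s 0 + T) / 2 →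
      c ((max t 0 + T) / 2) t = c ((max s 0 + T) / 2) t := by
    intro t ht0 ht
    have htT : t < T := ht.trans (hτ s hs.2).2
    have htτ : t ≤ (max t 0 + T) / 2 := by
      rw [max_eq_left ht0]; linarith
    exact eqOn_of_isCriticalCurveAt hN (htT.le.trans hT)
      (fun r hr ↦ hc _ (hτ t htT) r ⟨hr.1, hr.2.trans htτ⟩)
      (fun r hr ↦ hc _ (hτ s hs.2) r ⟨hr.1, hr.2.trans ht.le⟩)
      ((hc0 _ (hτ t htT)).trans (hc0 _ (hτ s hs.2)).symm) ⟨ht0, le_rfl⟩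
  rcases hs.1.lt_or_eq with hs0 | rfl
  · filter_upwards [Ioo_mem_nhds hs0 hsτ] with t ht
    exact hright t ht.1.le ht.2
  · filter_upwards [Iio_mem_nhds hsτ] with t ht
    rcases le_or_gt 0 t with ht0 | ht0
    · exact hright t ht0 ht
    · rw [max_eq_right ht0.le, max_self]

theorem exists_criticalCurve_Icc [IsRiemannianManifold 𝓘(ℝ, E) M] [CompleteSpace M]
    (hN : IsNondegenerate E f U L) (hL : 0 < L)
    (hball : {z : M | edist x₀ z < ENNReal.ofReal L} ⊆ U) (hx₀ : x₀ ∈ U)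
    (hcrit : grad 𝓘(ℝ, E) f x₀ 0 = 0) :
    ∃ x : ℝ → M, x 0 = x₀ ∧ ∀ s ∈ Icc (0 : ℝ) 1, IsCriticalCurveAt E f U x s := by
  let S : Set ℝ := {T | ∃ x : ℝ → M, x 0 = x₀ ∧ ∀ s ∈ Icc 0 T, IsCriticalCurveAt E f U x s}
  have hanti : ∀ T ∈ S, ∀ T' ≤ T, T' ∈ S := fun T ⟨x, h0, hx⟩ T' hT' ↦
    ⟨x, h0, fun s hs ↦ hx s ⟨hs.1, hs.2.trans hT'⟩⟩
  have h0S : (0 : ℝ) ∈ S := by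
    have h0I : (0 : ℝ) ∈ Icc (0 : ℝ) 1 := ⟨le_rfl, zero_le_one⟩
    obtain ⟨γ, hγz, hγd, hγ0, -⟩ := exists_critical_curve (hN.contMDiffAt x₀ hx₀ 0 h0I) hcrit
      (hN.injective x₀ hx₀ 0 h0I)
    refine ⟨γ, hγz, fun s hs ↦ ?_⟩
    rw [le_antisymm hs.2 hs.1]
    exact ⟨hγd, hγ0, by rwa [hγz]⟩
  have hlimit : ∀ T, 0 < T → T ≤ 1 → (∀ T' ∈ Ico 0 T, T' ∈ S) → T ∈ S := by
    intro T hT0 hT h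
    obtain ⟨x, hx0, hx⟩ := exists_glue_Ico hN hT0 hT h
    exact exists_extension_Icc hN hL hball hT0 hT hx0 hx
  have hstep : ∀ T ∈ S, 0 ≤ T → ∃ T' > T, T' ∈ S := by
    rintro T ⟨x, hx0, hx⟩ hT0
    obtain ⟨ε, hε, hball⟩ := Metric.eventually_nhds_iff.1 ((hx T ⟨hT0, le_rfl⟩).eventually hN.isOpen)
    refine ⟨T + ε / 2, by linarith, x, hx0, fun s hs ↦ ?_⟩
    rcases le_or_gt s T with h | h
    · exact hx s ⟨hs.1, h⟩
    · refine hball ?_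
      rw [Real.dist_eq, abs_of_pos (sub_pos.2 h)]
      linarith [hs.2]
  by_contra h1
  have h1S : (1 : ℝ) ∉ S := h1
  have hbdd : ∀ T ∈ S, T < 1 := fun T hT ↦ not_le.1 fun h ↦ h1S (hanti T hT 1 h)
  have hlub := isLUB_csSup ⟨0, h0S⟩ ⟨1, fun T hT ↦ (hbdd T hT).le⟩
  have hsup0 : 0 ≤ sSup S := hlub.1 h0S
  have hsupS : sSup S ∈ S := by
    rcases hsup0.eq_or_lt with h | h
    · rwa [← h]
    · refine hlimit _ h (hlub.2 fun T hT ↦ (hbdd T hT).le) fun T' hT' ↦ ?_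
      obtain ⟨T, hTS, hT⟩ := (lt_isLUB_iff hlub).1 hT'.2
      exact hanti T hTS T' hT.le
  obtain ⟨T', hT', hT'S⟩ := hstep _ hsupS hsup0
  exact (hlub.1 hT'S).not_gt hT'

end Continuation

end RiemannianContinuation

end

theorem theorem3p1 {E : Type*} [NormedAddCommGroup E] [NormedSpace ℝ E] [FiniteDimensional ℝ E]
    {d : ℕ} (hd : Module.finrank ℝ E = d)
    {M : Type*} [EMetricSpace M] [ChartedSpace E M]
    [IsManifold 𝓘(ℝ, E) ∞ M]
    [RiemannianBundle (fun x : M ↦ TangentSpace 𝓘(ℝ, E) x)]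
    [IsContMDiffRiemannianBundle 𝓘(ℝ, E) ∞ E (fun x : M ↦ TangentSpace 𝓘(ℝ, E) x)]
    [IsRiemannianManifold 𝓘(ℝ, E) M] [CompleteSpace M]
    (U : Set M) (hU : IsOpen U) (V : Set (M × ℝ)) (hV : IsOpen V)
    (hUV : U ×ˢ Icc (0 : ℝ) 1 ⊆ V)
    (f : M × ℝ → ℝ) (hf : ContMDiffOn (𝓘(ℝ, E).prod 𝓘(ℝ, ℝ)) 𝓘(ℝ, ℝ) 2 f V)
    (x₀ : M) (hx₀ : x₀ ∈ U) (hcrit : RiemannianContinuation.grad 𝓘(ℝ, E) f x₀ 0 = 0)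
    (L : ℝ) (hL : 0 < L) (hball : {x : M | edist x₀ x < ENNReal.ofReal L} ⊆ U)
    (hrank : ∀ z ∈ U, ∀ lam ∈ Icc (0 : ℝ) 1,
      Module.finrank ℝ (RiemannianContinuation.hess 𝓘(ℝ, E) f z lam).range = d)
    (hbound : ∀ z ∈ U, ∀ lam ∈ Icc (0 : ℝ) 1,
      ‖(RiemannianContinuation.hess 𝓘(ℝ, E) f z lam).inverse
        (RiemannianContinuation.partialGrad 𝓘(ℝ, E) f z lam)‖ < L) :
    ∃ (J : Set ℝ) (x : ℝ → M), IsOpen J ∧ J.OrdConnected ∧ Icc (0 : ℝ) 1 ⊆ J ∧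
      ContMDiffOn 𝓘(ℝ, ℝ) 𝓘(ℝ, E) 1 x J ∧
      x 0 = x₀ ∧
      (∀ lam ∈ Icc (0 : ℝ) 1,
        x lam ∈ U ∧
        RiemannianContinuation.grad 𝓘(ℝ, E) f (x lam) lam = 0 ∧
        RiemannianContinuation.hess 𝓘(ℝ, E) f (x lam) lam (mfderiv 𝓘(ℝ, ℝ) 𝓘(ℝ, E) x lam (1 : ℝ))
          + RiemannianContinuation.partialGrad 𝓘(ℝ, E) f (x lam) lam = 0) := by
  have hN : RiemannianContinuation.IsNondegenerate E f U L :=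
    { isOpen := hU
      contMDiffAt := fun z hz s hs ↦ hf.contMDiffAt (hV.mem_nhds (hUV ⟨hz, hs⟩))
      injective := fun z hz s hs ↦
        RiemannianContinuation.hess_injective ((hrank z hz s hs).trans hd.symm)
      norm_lt := hbound }
  obtain ⟨x, hx0, hx⟩ :=
    RiemannianContinuation.exists_criticalCurve_Icc hN hL hball hx₀ hcrit
  obtain ⟨ε₀, hε₀, hleft⟩ := Metric.eventually_nhds_iff.1
    ((hx 0 ⟨le_rfl, zero_le_one⟩).eventually hU)
  obtain ⟨ε₁, hε₁, hright⟩ := Metric.eventually_nhds_iff.1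
    ((hx 1 ⟨zero_le_one, le_rfl⟩).eventually hU)
  refine ⟨Ioo (-ε₀) (1 + ε₁), x, isOpen_Ioo, ordConnected_Ioo, ?_, ?_, hx0, fun s hs ↦ ?_⟩
  · exact fun s hs ↦ ⟨by linarith [hs.1], by linarith [hs.2]⟩
  · intro s hs
    refine ContMDiffAt.contMDiffWithinAt ?_
    rcases lt_or_ge s 0 with h0 | h0
    · refine (hleft ?_).contMDiffAt
      rw [Real.dist_eq, sub_zero, abs_of_neg h0]
      linarith [hs.1]
    rcases le_or_gt s 1 with h1 | h1
    · exact (hx s ⟨h0, h1⟩).contMDiffAt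
    · refine (hright ?_).contMDiffAt
      rw [Real.dist_eq, abs_of_pos (sub_pos.2 h1)]
      linarith [hs.2]
  · exact ⟨(hx s hs).mem, (hx s hs).grad_eq_zero.self_of_nhds,
      RiemannianContinuation.davidenko ((hx s hs).contMDiffAt.mdifferentiableAt one_ne_zero)
        (hN.contMDiffAt _ (hx s hs).mem s hs) (hx s hs).grad_eq_zero⟩
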